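/- Let $N\ge 1$, let $0\le\alpha\le 1$ and let $R,Q$ be column-stochastic $N\times N$ matrices (nonnegative entries, columns summing to $1$). A second-order retrospective higher-order Markov process (RHOMP) with parameters $\alpha,R,Q$ is a process $X_1,X_2,\dots$ on $\{1,\dots,N\}$, with an arbitrary joint law of $(X_1,X_2)$, such that for all $t\ge 3$ $$\Pr\big(X_t=i\mid X_{t-1}=j,\,X_{t-2}=k,\,X_{t-3}=i_{t-3},\dots,X_1=i_1\big)=\alpha R_{i,j}+(1-\alpha)Q_{i,k}$$ whenever the event conditioned on has positive probability. Put $P=\alpha R+(1-\alpha)Q$. Then: (1) For every joint law of $(X_1,X_2)$ such a process exists. For every such process, almost surely, the long-run fractions of time $$x_i=\lim_{t\to\infty}\frac{\#\{s\le t: X_s=i\}}{t},\qquad Y_{j,k}=\lim_{t\to\infty}\frac{\#\{s\le t: X_{s+1}=j,\ X_s=k\}}{t}$$ exist for all states $i,j,k$ (they may depend on the initial law and on the trajectory). They are probability distributions on the states and on the pairs of states, $Y$ is stationary for the first-order chain of pairs, i.e. $Y_{i,j}=\sum_k(\alpha R_{i,j}+(1-\alpha)Q_{i,k})Y_{j,k}$,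 both marginals of $Y$ are equal to $x$, i.e. $x_i=\sum_j Y_{i,j}=\sum_j Y_{j,i}$, and $x=Px$. (2) If $P$ is irreducible, then the limiting distribution $x$ is unique: there is one probability vector $x$, the only one with $x=Px$, such that for every process with the parameters $\alpha,R,Q$, whatever the law of $(X_1,X_2)$, almost surely $\#\{s\le t: X_s=i\}/t\to x_i$ for every $i$. -/

import Mathlib

open MeasureTheory Filter Topology

noncomputable section

/-- The parameters `α, R, Q` of a second-order retrospective higher-order Markov process (RHOMP)
on the states `Fin N`.  Matrices act on column vectors: `R i j` is the probability to move from
`j` to `i`, so the columns of a stochastic matrix sum to one. -/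
structure RHOMPModel (N : ℕ) where
  /-- the probability that the current state is selected from the history -/
  α : ℝ
  /-- the transitions from the current state, when that one is selected -/
  R : Matrix (Fin N) (Fin N) ℝ
  /-- the transitions from the previous state, when that one is selected -/
  Q : Matrix (Fin N) (Fin N) ℝ
  α_nonneg : 0 ≤ α
  α_le_one : α ≤ 1
  R_stochastic : R ∈ Matrix.colStochastic ℝ (Fin N)
  Q_stochastic : Q ∈ Matrix.colStochastic ℝ (Fin N)

namespace RHOMPModel

variable {N : ℕ}

/-- The probability to move to `i` from the current state `j` with previous state `k`. -/
def trans (M : RHOMPModel N) (i j k : Fin N) : ℝ :=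
  M.α * M.R i j + (1 - M.α) * M.Q i k

/-- The matrix `αR + (1 - α)Q`. -/
def mix (M : RHOMPModel N) : Matrix (Fin N) (Fin N) ℝ :=
  M.α • M.R + (1 - M.α) • M.Q

/-- `X 0, X 1, X 2, …` is a RHOMP with the parameters `M` under the law `μ`, with an arbitrary joint
law of `(X 0, X 1)`: conditionally on the whole history `X 0 = a 0, …, X (n + 1) = a (n + 1)`, the
probability of `X (n + 2) = a (n + 2)` is `M.trans (a (n + 2)) (a (n + 1)) (a n)`.  The conditional
probability is multiplied out, so that nothing is required after a history of probability zero. -/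
structure IsRHOMP (M : RHOMPModel N) {Ω : Type*} [MeasurableSpace Ω] (μ : Measure Ω)
    (X : ℕ → Ω → Fin N) : Prop where
  measurable : ∀ t, Measurable (X t)
  transition : ∀ (a : ℕ → Fin N) (n : ℕ),
    μ.real {ω | ∀ s ≤ n + 2, X s ω = a s} =
      μ.real {ω | ∀ s ≤ n + 1, X s ω = a s} * M.trans (a (n + 2)) (a (n + 1)) (a n)

end RHOMPModel

/-- The fraction of the first `t` time steps at which the trajectory `u` is in the state `i`. -/
def visitFraction {S : Type*} [DecidableEq S] (u : ℕ → S) (i : S) (t : ℕ) : ℝ :=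
  (((Finset.range t).filter fun s => u s = i).card : ℝ) / (t : ℝ)

end

/-! The pairs `(X (t + 1), X t)` form a first-order Markov chain on a finite set, with a transition
operator `T` on functions that contracts the sup norm. Hence every function is `h + (g - T g)` with
`T h = h` (`exists_fixed_add_coboundary`). Along the chain `h` is a bounded martingale, so it
converges; averages of `g - T g` vanish by the strong law for martingale differences and
telescoping. So all time averages converge (`ae_exists_tendsto_average`), with no decomposition into
recurrent classes. Averaging `f - T f` for indicators `f` gives stationarity of `Y`. Both marginals
of `Y` are time averages of one trajectory up to a shift, hence equal, and summing the stationarity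
equation gives `x = Px`. For irreducible `P` the fixed distribution is unique by passing to absolute
values. Processes are built by the Ionescu-Tulcea theorem. -/

/-! ### Decomposition for contractions and Kronecker's lemma. -/

/-- In finite dimension, every vector is the sum of a fixed vector of a contraction `T` and of a
coboundary `g - T g`. -/
theorem exists_fixed_add_coboundary {E : Type*} [NormedAddCommGroup E] [NormedSpace ℝ E]
    [FiniteDimensional ℝ E] (T : E →ₗ[ℝ] E) (hT : ∀ f, ‖T f‖ ≤ ‖f‖) (f : E) :
    ∃ h g, T h = h ∧ f = h + (g - T g) := by
  set D : E →ₗ[ℝ] E := LinearMap.id - T with hD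
  have hdisj : Disjoint (LinearMap.ker D) (LinearMap.range D) := by
    rw [Submodule.disjoint_def]
    rintro h hker ⟨g, rfl⟩
    set h := D g with hh
    have hTh : T h = h := by
      have : h - T h = 0 := by simpa [hD] using hker
      exact (sub_eq_zero.1 this).symm
    have hTg : T g = g - h := by simp [hh, hD]
    -- Here `g - n • h` is the `n`-th iterate of `T` at `g`, so it stays bounded, which forces `h =
    -- 0`.
    have hpow (n : ℕ) : ‖g - (n : ℝ) • h‖ ≤ ‖g‖ := by
      induction n with
      | zero => simp
      | succ n ih =>
        have : g - ((n + 1 : ℕ) : ℝ) • h = T (g - (n : ℝ) • h) := by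
          rw [map_sub, map_smul, hTh, hTg]
          push_cast
          module
        rw [this]
        exact (hT _).trans ih
    by_contra hne
    have hpos : 0 < ‖h‖ := norm_pos_iff.2 hne
    obtain ⟨n, hn⟩ := exists_nat_gt (2 * ‖g‖ / ‖h‖)
    rw [div_lt_iff₀ hpos] at hn
    have h1 : ‖(n : ℝ) • h‖ ≤ ‖g - (n : ℝ) • h‖ + ‖g‖ := by
      have := norm_sub_le g (g - (n : ℝ) • h)
      rw [sub_sub_cancel] at this
      linarith
    rw [norm_smul, Real.norm_natCast] at h1
    linarith [hpow n]
  have hcompl : IsCompl (LinearMap.ker D) (LinearMap.range D) := by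
    rw [Submodule.isCompl_iff_disjoint]
    · exact hdisj
    · rw [add_comm, LinearMap.finrank_range_add_finrank_ker]
  have hmem : f ∈ LinearMap.ker D ⊔ LinearMap.range D := by rw [hcompl.sup_eq_top]; trivial
  obtain ⟨h, hh, _, ⟨g, rfl⟩, hfg⟩ := Submodule.mem_sup.1 hmem
  refine ⟨h, g, ?_, by simpa [hD] using hfg.symm⟩
  have : h - T h = 0 := by simpa [hD] using hh
  exact (sub_eq_zero.1 this).symm

/-- **Kronecker's lemma** with the weights `1 / (k + 1)`. -/
theorem tendsto_average_of_tendsto_sum_div {a : ℕ → ℝ} {s : ℝ}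
    (h : Tendsto (fun n : ℕ => ∑ k ∈ Finset.range n, a k / (k + 1)) atTop (𝓝 s)) :
    Tendsto (fun n : ℕ => (n : ℝ)⁻¹ * ∑ k ∈ Finset.range n, a k) atTop (𝓝 0) := by
  set b : ℕ → ℝ := fun n => ∑ k ∈ Finset.range n, a k / (k + 1) with hb
  -- Summation by parts: the average of `a` becomes `b n` minus the Cesàro mean of `b`, and both
  -- tend to `s`.
  have hsum (n : ℕ) :
      ∑ k ∈ Finset.range n, a k = n * b n - ∑ k ∈ Finset.range n, b k := by
    induction n with
    | zero => simp
    | succ n ih =>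
      have : b (n + 1) = b n + a n / (n + 1) := Finset.sum_range_succ _ _
      rw [Finset.sum_range_succ, Finset.sum_range_succ, ih, this]
      have : (n : ℝ) + 1 ≠ 0 := by positivity
      push_cast
      field_simp
      ring
  have hlim := h.sub h.cesaro
  rw [sub_self] at hlim
  refine hlim.congr' ?_
  filter_upwards [eventually_gt_atTop 0] with n hn
  have : (n : ℝ) ≠ 0 := by positivity
  rw [hsum]
  field_simp

/-! ### Strong law and ergodic theorem for finite chains. -/

section Martingale

variable {Ω : Type*} {m0 : MeasurableSpace Ω} {μ : Measure Ω} [IsProbabilityMeasure μ]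
  {ℱ : Filtration ℕ m0}

/-- Since `|f| ≤ 1 + f²`, an L² bound yields the L¹ bound that martingale convergence asks for. -/
theorem eLpNorm_one_le_of_integral_sq_le {f : Ω → ℝ} {K : ℝ} (hf : AEStronglyMeasurable f μ)
    (hsq : Integrable (fun ω => f ω ^ 2) μ) (hK : ∫ ω, f ω ^ 2 ∂μ ≤ K) :
    eLpNorm f 1 μ ≤ ENNReal.ofReal (1 + K) := by
  have h1 : (fun ω => ‖f ω‖) ≤ fun ω => 1 + f ω ^ 2 := by
    intro ω
    have : f ω ^ 2 = ‖f ω‖ ^ 2 := by simp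
    simp only [this]
    nlinarith [norm_nonneg (f ω), sq_nonneg (‖f ω‖ - 1)]
  have hint : Integrable (fun ω => 1 + f ω ^ 2) μ := (integrable_const _).add hsq
  have hfi : Integrable f μ := hint.mono' hf (ae_of_all _ h1)
  rw [eLpNorm_one_eq_lintegral_enorm, ← ofReal_integral_norm_eq_lintegral_enorm hfi]
  apply ENNReal.ofReal_le_ofReal
  calc ∫ ω, ‖f ω‖ ∂μ ≤ ∫ ω, (1 + f ω ^ 2) ∂μ := integral_mono hfi.norm hint h1
    _ = 1 + ∫ ω, f ω ^ 2 ∂μ := by rw [integral_add (integrable_const _) hsq]; simp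
    _ ≤ 1 + K := by linarith

/-- The **strong law of large numbers** for bounded martingale differences. -/
theorem ae_tendsto_average_of_martingale_differences {D : ℕ → Ω → ℝ} {C : ℝ}
    (hadp : ∀ n, StronglyMeasurable[ℱ (n + 1)] (D n)) (hbdd : ∀ n ω, |D n ω| ≤ C)
    (hcond : ∀ n, μ[D n | ℱ n] =ᵐ[μ] 0) :
    ∀ᵐ ω ∂μ, Tendsto (fun n : ℕ => (n : ℝ)⁻¹ * ∑ k ∈ Finset.range n, D k ω) atTop (𝓝 0) := by
  -- The weights `1 / (k + 1)` are square summable, so this martingale is bounded in L²; Kronecker's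
  -- lemma then removes them.
  set M : ℕ → Ω → ℝ := fun n ω => ∑ k ∈ Finset.range n, D k ω / (k + 1) with hM
  have hsucc (n : ℕ) (ω : Ω) : M (n + 1) ω = M n ω + D n ω / (n + 1) := Finset.sum_range_succ _ _
  have hMadp (n : ℕ) : StronglyMeasurable[ℱ n] (M n) := by
    refine Finset.stronglyMeasurable_fun_sum _ fun k hk => ?_
    have := (hadp k).mono (ℱ.mono (Finset.mem_range.1 hk))
    simpa only [div_eq_mul_inv] using this.mul_const _
  have hMbdd (n : ℕ) : ∃ K, ∀ ω, |M n ω| ≤ K := by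
    induction n with
    | zero => exact ⟨0, fun ω => by simp [hM]⟩
    | succ n ih =>
      obtain ⟨K, hK⟩ := ih
      refine ⟨K + C / (n + 1), fun ω => ?_⟩
      rw [hsucc]
      refine (abs_add_le _ _).trans (add_le_add (hK ω) ?_)
      have hn : (0 : ℝ) < n + 1 := by positivity
      rw [abs_div, abs_of_pos hn]
      gcongr
      exact hbdd n ω
  have hDm (n : ℕ) : StronglyMeasurable (D n) := (hadp n).mono (ℱ.le _)
  have hMm (n : ℕ) : StronglyMeasurable (M n) := (hMadp n).mono (ℱ.le _)
  have hint {f : Ω → ℝ} (hf : StronglyMeasurable f) (hb : ∃ K, ∀ ω, |f ω| ≤ K) :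
      Integrable f μ := by
    obtain ⟨K, hK⟩ := hb
    exact Integrable.of_bound hf.aestronglyMeasurable K (ae_of_all _ hK)
  have hDint (n : ℕ) : Integrable (D n) μ := hint (hDm n) ⟨C, hbdd n⟩
  have hMint (n : ℕ) : Integrable (M n) μ := hint (hMm n) (hMbdd n)
  have hDsq (n : ℕ) : Integrable (fun ω => D n ω ^ 2) μ :=
    hint ((hDm n).pow 2) ⟨C ^ 2, fun ω => by
      rw [abs_pow]; exact pow_le_pow_left₀ (abs_nonneg _) (hbdd n ω) 2⟩
  have hMsq (n : ℕ) : Integrable (fun ω => M n ω ^ 2) μ := by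
    obtain ⟨K, hK⟩ := hMbdd n
    exact hint ((hMm n).pow 2) ⟨K ^ 2, fun ω => by
      rw [abs_pow]; exact pow_le_pow_left₀ (abs_nonneg _) (hK ω) 2⟩
  have hMD (n : ℕ) : Integrable (M n * D n) μ := by
    obtain ⟨K, hK⟩ := hMbdd n
    refine hint ((hMm n).mul (hDm n)) ⟨K * C, fun ω => ?_⟩
    rw [Pi.mul_apply, abs_mul]
    exact mul_le_mul (hK ω) (hbdd n ω) (abs_nonneg _) ((abs_nonneg _).trans (hK ω))
  have hmart : Martingale M ℱ μ := by
    refine martingale_of_condExp_sub_eq_zero_nat hMadp hMint fun n => ?_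
    have : M (n + 1) - M n = (((n : ℝ) + 1)⁻¹) • D n := by
      ext ω
      simp [hsucc, div_eq_inv_mul]
    rw [this]
    refine (condExp_smul _ _ _).trans ?_
    filter_upwards [hcond n] with ω hω
    simp [hω]
  -- `M n` is known at time `n` and can be pulled out of the conditional expectation: the cross term
  -- of the square vanishes.
  have horth (n : ℕ) : ∫ ω, M n ω * D n ω ∂μ = 0 := by
    have h1 : μ[M n * D n | ℱ n] =ᵐ[μ] 0 := by
      refine (condExp_mul_of_stronglyMeasurable_left (hMadp n) (hMD n) (hDint n)).trans ?_
      filter_upwards [hcond n] with ω hω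
      simp [hω]
    have h2 := integral_condExp (μ := μ) (f := M n * D n) (ℱ.le n)
    rw [integral_congr_ae h1] at h2
    simpa using h2.symm
  have hstep (n : ℕ) : ∫ ω, M (n + 1) ω ^ 2 ∂μ ≤
      ∫ ω, M n ω ^ 2 ∂μ + C ^ 2 * (1 / ((n : ℝ) + 1) ^ 2) := by
    have h1 : ∀ ω, M (n + 1) ω ^ 2 = M n ω ^ 2 + 2 / ((n : ℝ) + 1) * (M n ω * D n ω)
        + 1 / ((n : ℝ) + 1) ^ 2 * D n ω ^ 2 := by
      intro ω
      have : (n : ℝ) + 1 ≠ 0 := by positivity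
      rw [hsucc]
      field_simp
      ring
    have hMD' : Integrable (fun ω => 2 / ((n : ℝ) + 1) * (M n ω * D n ω)) μ :=
      (hMD n).const_mul _
    have hDsq' : Integrable (fun ω => 1 / ((n : ℝ) + 1) ^ 2 * D n ω ^ 2) μ :=
      (hDsq n).const_mul _
    have h2 : ∫ ω, D n ω ^ 2 ∂μ ≤ C ^ 2 := by
      calc ∫ ω, D n ω ^ 2 ∂μ ≤ ∫ _, C ^ 2 ∂μ :=
            integral_mono (hDsq n) (integrable_const _) fun ω => by
              simp only
              rw [← sq_abs]
              exact pow_le_pow_left₀ (abs_nonneg _) (hbdd n ω) 2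
        _ = C ^ 2 := by simp
    have hMM : Integrable (fun ω => M n ω ^ 2 + 2 / ((n : ℝ) + 1) * (M n ω * D n ω)) μ :=
      (hMsq n).add hMD'
    simp_rw [h1]
    rw [integral_add hMM hDsq', integral_add (hMsq n) hMD',
      integral_const_mul, integral_const_mul, horth, mul_zero, add_zero, mul_comm (C ^ 2)]
    gcongr
  have hsummable : Summable fun n : ℕ => 1 / ((n : ℝ) + 1) ^ 2 := by
    have := (summable_nat_add_iff 1).2 (Real.summable_one_div_nat_pow.2 one_lt_two)
    simpa using this
  have hL2 (n : ℕ) : ∫ ω, M n ω ^ 2 ∂μ ≤ C ^ 2 * ∑' k : ℕ, 1 / ((k : ℝ) + 1) ^ 2 := by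
    have h1 : ∫ ω, M n ω ^ 2 ∂μ ≤ C ^ 2 * ∑ k ∈ Finset.range n, 1 / ((k : ℝ) + 1) ^ 2 := by
      induction n with
      | zero => simp [hM]
      | succ n ih => rw [Finset.sum_range_succ, mul_add]; linarith [hstep n]
    refine h1.trans (mul_le_mul_of_nonneg_left ?_ (sq_nonneg C))
    exact hsummable.sum_le_tsum _ fun k _ => by positivity
  have hconv := hmart.submartingale.exists_ae_tendsto_of_bdd
    (R := Real.toNNReal (1 + C ^ 2 * ∑' k : ℕ, 1 / ((k : ℝ) + 1) ^ 2))
    fun n => eLpNorm_one_le_of_integral_sq_le (hMm n).aestronglyMeasurable (hMsq n) (hL2 n)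
  filter_upwards [hconv] with ω ⟨s, hs⟩
  exact tendsto_average_of_tendsto_sum_div hs

variable {S : Type*} [Fintype S] {T : (S → ℝ) →ₗ[ℝ] (S → ℝ)} {Z : ℕ → Ω → S}

/-- For a process `Z` in a finite state space with transition operator `T`, the averages of
`f - T f` along almost every trajectory tend to zero. -/
theorem ae_tendsto_average_coboundary
    (hadp : ∀ (f : S → ℝ) n, StronglyMeasurable[ℱ n] fun ω => f (Z n ω))
    (hmarkov : ∀ (f : S → ℝ) n, μ[fun ω => f (Z (n + 1) ω) | ℱ n] =ᵐ[μ] fun ω => T f (Z n ω))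
    (f : S → ℝ) :
    ∀ᵐ ω ∂μ, Tendsto (fun n : ℕ => (n : ℝ)⁻¹ * ∑ k ∈ Finset.range n, (f - T f) (Z k ω))
      atTop (𝓝 0) := by
  have hint (g : S → ℝ) (n : ℕ) : Integrable (fun ω => g (Z n ω)) μ :=
    Integrable.of_bound ((hadp g n).mono (ℱ.le n)).aestronglyMeasurable ‖g‖
      (ae_of_all _ fun ω => norm_le_pi_norm g _)
  have h1 := ae_tendsto_average_of_martingale_differences (μ := μ) (ℱ := ℱ)
    (D := fun n ω => f (Z (n + 1) ω) - T f (Z n ω)) (C := ‖f‖ + ‖T f‖)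
    (fun n => (hadp f (n + 1)).sub ((hadp (T f) n).mono (ℱ.mono n.le_succ)))
    (fun n ω => (abs_sub _ _).trans (add_le_add (norm_le_pi_norm f _) (norm_le_pi_norm (T f) _)))
    (fun n => by
      refine (condExp_sub (hint f (n + 1)) (hint (T f) n) (ℱ n)).trans ?_
      rw [condExp_of_stronglyMeasurable (ℱ.le n) (hadp (T f) n) (hint (T f) n)]
      filter_upwards [hmarkov f n] with ω hω
      simp [hω])
  filter_upwards [h1] with ω hω
  -- The sums of `(f - T f) (Z k)` and of the martingale differences differ by the telescoping
  -- boundary term `f (Z 0) - f (Z n)`.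
  have h2 : Tendsto (fun n : ℕ => (n : ℝ)⁻¹ * (f (Z 0 ω) - f (Z n ω))) atTop (𝓝 0) := by
    have h3 : Tendsto (fun n : ℕ => (n : ℝ)⁻¹ * (2 * ‖f‖)) atTop (𝓝 0) := by
      simpa using tendsto_inv_atTop_nhds_zero_nat.mul_const (2 * ‖f‖)
    refine squeeze_zero_norm (fun n => ?_) h3
    rw [norm_mul, norm_inv, Real.norm_natCast]
    gcongr
    refine (norm_sub_le _ _).trans ?_
    linarith [norm_le_pi_norm f (Z 0 ω), norm_le_pi_norm f (Z n ω)]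
  have h4 := hω.add h2
  rw [add_zero] at h4
  refine h4.congr fun n => ?_
  rw [← mul_add, ← Finset.sum_range_sub' (fun k => f (Z k ω)), ← Finset.sum_add_distrib]
  congr 1
  exact Finset.sum_congr rfl fun k _ => by simp

/-- The **ergodic theorem** for a process `Z` in a finite state space with a contractive
transition operator `T`: the averages of every function converge almost surely. -/
theorem ae_exists_tendsto_average
    (hadp : ∀ (f : S → ℝ) n, StronglyMeasurable[ℱ n] fun ω => f (Z n ω))
    (hmarkov : ∀ (f : S → ℝ) n, μ[fun ω => f (Z (n + 1) ω) | ℱ n] =ᵐ[μ] fun ω => T f (Z n ω))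
    (hT : ∀ f, ‖T f‖ ≤ ‖f‖) (f : S → ℝ) :
    ∀ᵐ ω ∂μ, ∃ c, Tendsto (fun n : ℕ => (n : ℝ)⁻¹ * ∑ k ∈ Finset.range n, f (Z k ω))
      atTop (𝓝 c) := by
  obtain ⟨h, g, hh, hfg⟩ := exists_fixed_add_coboundary T hT f
  have hint (n : ℕ) : Integrable (fun ω => h (Z n ω)) μ :=
    Integrable.of_bound ((hadp h n).mono (ℱ.le n)).aestronglyMeasurable ‖h‖
      (ae_of_all _ fun ω => norm_le_pi_norm h _)
  have hmart : Martingale (fun n ω => h (Z n ω)) ℱ μ :=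
    martingale_nat (hadp h) hint fun n => by
      filter_upwards [hmarkov h n] with ω hω
      rw [hω, hh]
  have hconv := hmart.submartingale.exists_ae_tendsto_of_bdd (R := ‖h‖₊) fun n => by
    refine (eLpNorm_le_of_ae_bound (C := ‖h‖) (ae_of_all _ fun ω => norm_le_pi_norm h _)).trans ?_
    simp
  filter_upwards [hconv, ae_tendsto_average_coboundary hadp hmarkov g] with ω ⟨c, hc⟩ hg
  refine ⟨c + 0, (hc.cesaro.add hg).congr fun n => ?_⟩
  rw [← mul_add, ← Finset.sum_add_distrib]
  congr 1
  refine Finset.sum_congr rfl fun k _ => ?_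
  rw [hfg]
  simp

end Martingale

/-! ### The chain of pairs and its Markov property. -/

namespace RHOMPModel

variable {N : ℕ}

theorem trans_nonneg (M : RHOMPModel N) (i j k : Fin N) : 0 ≤ M.trans i j k :=
  add_nonneg (mul_nonneg M.α_nonneg (Matrix.nonneg_of_mem_colStochastic M.R_stochastic))
    (mul_nonneg (sub_nonneg.2 M.α_le_one) (Matrix.nonneg_of_mem_colStochastic M.Q_stochastic))

theorem sum_trans (M : RHOMPModel N) (j k : Fin N) : ∑ i, M.trans i j k = 1 := by
  simp only [trans, Finset.sum_add_distrib, ← Finset.mul_sum]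
  rw [Matrix.sum_col_of_mem_colStochastic M.R_stochastic,
    Matrix.sum_col_of_mem_colStochastic M.Q_stochastic]
  ring

/-- The transition operator, acting on functions, of the first-order chain of the pairs
`(current state, previous state)`. -/
noncomputable def pairOp (M : RHOMPModel N) : (Fin N × Fin N → ℝ) →ₗ[ℝ] (Fin N × Fin N → ℝ) where
  toFun f p := ∑ i, M.trans i p.1 p.2 * f (i, p.1)
  map_add' f g := by
    ext p
    simp [mul_add, Finset.sum_add_distrib]
  map_smul' c f := by
    ext p
    simp only [Pi.smul_apply, smul_eq_mul, RingHom.id_apply, Finset.mul_sum]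
    exact Finset.sum_congr rfl fun i _ => by ring

theorem pairOp_apply (M : RHOMPModel N) (f : Fin N × Fin N → ℝ) (p : Fin N × Fin N) :
    M.pairOp f p = ∑ i, M.trans i p.1 p.2 * f (i, p.1) := rfl

theorem norm_pairOp_le (M : RHOMPModel N) (f : Fin N × Fin N → ℝ) : ‖M.pairOp f‖ ≤ ‖f‖ := by
  refine (pi_norm_le_iff_of_nonneg (norm_nonneg f)).2 fun p => ?_
  rw [pairOp_apply]
  calc ‖∑ i, M.trans i p.1 p.2 * f (i, p.1)‖ ≤ ∑ i, M.trans i p.1 p.2 * ‖f‖ := by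
        refine norm_sum_le_of_le _ fun i _ => ?_
        rw [norm_mul, Real.norm_of_nonneg (M.trans_nonneg _ _ _)]
        exact mul_le_mul_of_nonneg_left (norm_le_pi_norm f _) (M.trans_nonneg _ _ _)
    _ = ‖f‖ := by rw [← Finset.sum_mul, sum_trans, one_mul]

end RHOMPModel

section History

variable {N : ℕ} {Ω : Type*} {m0 : MeasurableSpace Ω} {X : ℕ → Ω → Fin N}

/-- The first `n + 2` states of a process. -/
def history (X : ℕ → Ω → Fin N) (n : ℕ) (ω : Ω) (s : Fin (n + 2)) : Fin N := X s ω

/-- The filtration whose `n`-th σ-algebra is generated by the first `n + 2` states. -/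
def historyFiltration (hX : ∀ t, Measurable (X t)) : Filtration ℕ m0 where
  seq n := MeasurableSpace.comap (history X n) inferInstance
  mono' n m hnm := by
    have h : history X n =
        (fun (u : Fin (m + 2) → Fin N) (s : Fin (n + 2)) => u (s.castLE (by lia))) ∘
          history X m := rfl
    change MeasurableSpace.comap (history X n) _ ≤ _
    rw [h, ← MeasurableSpace.comap_comp]
    exact MeasurableSpace.comap_mono (measurable_of_countable _).comap_le
  le' n := (measurable_pi_lambda (history X n) fun s => hX s).comap_le

theorem measurable_history (hX : ∀ t, Measurable (X t)) (n : ℕ) : Measurable (history X n) :=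
  measurable_pi_lambda _ fun s => hX s

/-- The reason for `n + 2` states in the `n`-th σ-algebra: the `n`-th pair already involves `X (n +
1)`. -/
theorem stronglyMeasurable_historyFiltration (hX : ∀ t, Measurable (X t))
    (f : Fin N × Fin N → ℝ) (n : ℕ) :
    StronglyMeasurable[historyFiltration hX n] fun ω => f (X (n + 1) ω, X n ω) := by
  have h : (fun ω => f (X (n + 1) ω, X n ω)) =
      (fun u : Fin (n + 2) → Fin N => f (u ⟨n + 1, by lia⟩, u ⟨n, by lia⟩)) ∘ history X n := rfl
  rw [h]
  exact (measurable_of_countable _).stronglyMeasurable.comp_measurable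
    (comap_measurable (history X n))

theorem setIntegral_comp_of_fintype {μ : Measure Ω} [IsFiniteMeasure μ] {S : Type*} [Fintype S]
    [MeasurableSpace S] [MeasurableSingletonClass S] {Y : Ω → S} (hY : Measurable Y) (φ : S → ℝ)
    {A : Set Ω} :
    ∫ ω in A, φ (Y ω) ∂μ = ∑ i, μ.real (Y ⁻¹' {i} ∩ A) * φ i := by
  rw [← integral_map (φ := Y) hY.aemeasurable (measurable_of_finite φ).aestronglyMeasurable,
    integral_fintype (Integrable.of_finite)]
  refine Finset.sum_congr rfl fun i _ => ?_
  rw [map_measureReal_apply hY (measurableSet_singleton i),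
    measureReal_restrict_apply (hY (measurableSet_singleton i)), smul_eq_mul]

/-- The σ-algebra of a finite history is generated by finitely many atoms, so it suffices to compare
integrals over one atom. There the multiplied-out transition rule is exactly what is needed, for
null atoms too. -/
theorem RHOMPModel.IsRHOMP.condExp_pair {M : RHOMPModel N} {μ : Measure Ω}
    [IsProbabilityMeasure μ] (h : M.IsRHOMP μ X) (f : Fin N × Fin N → ℝ) (n : ℕ) :
    μ[fun ω => f (X (n + 2) ω, X (n + 1) ω) | historyFiltration h.measurable n] =ᵐ[μ]
      fun ω => M.pairOp f (X (n + 1) ω, X n ω) := by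
  have hm := h.measurable
  have hint (g : Fin N × Fin N → ℝ) (n : ℕ) : Integrable (fun ω => g (X (n + 1) ω, X n ω)) μ :=
    Integrable.of_bound ((stronglyMeasurable_historyFiltration hm g n).mono
      ((historyFiltration hm).le n)).aestronglyMeasurable ‖g‖
      (ae_of_all _ fun ω => norm_le_pi_norm g _)
  symm
  refine ae_eq_condExp_of_forall_setIntegral_eq ((historyFiltration hm).le n)
    (hint f (n + 1)) (fun _ _ _ => (hint _ n).integrableOn) ?_
    (stronglyMeasurable_historyFiltration hm _ n).aestronglyMeasurable
  rintro _ ⟨B, -, rfl⟩ -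
  have hH := measurable_history hm n
  classical
  have hB : history X n ⁻¹' B = ⋃ b ∈ B.toFinset, history X n ⁻¹' {b} := by
    ext ω
    simp
  have hmeas : ∀ b ∈ B.toFinset, MeasurableSet (history X n ⁻¹' {b}) := fun b _ =>
    hH (measurableSet_singleton b)
  have hdisj : Set.Pairwise (↑B.toFinset) (Function.onFun Disjoint fun b => history X n ⁻¹' {b}) :=
    fun b _ c _ hbc => Disjoint.preimage _ (by simpa using hbc)
  rw [hB, integral_biUnion_finset _ hmeas hdisj fun _ _ => (hint _ n).integrableOn,
    integral_biUnion_finset _ hmeas hdisj fun _ _ => (hint f (n + 1)).integrableOn]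
  refine Finset.sum_congr rfl fun b _ => ?_
  set j : Fin N := b ⟨n + 1, by lia⟩
  set k : Fin N := b ⟨n, by lia⟩
  have hj {ω : Ω} (hω : ω ∈ history X n ⁻¹' {b}) : X (n + 1) ω = j :=
    congrFun (Set.mem_singleton_iff.1 hω) ⟨n + 1, by lia⟩
  have hk {ω : Ω} (hω : ω ∈ history X n ⁻¹' {b}) : X n ω = k :=
    congrFun (Set.mem_singleton_iff.1 hω) ⟨n, by lia⟩
  have hbm := hH (measurableSet_singleton b)
  have hleft : ∫ ω in history X n ⁻¹' {b}, M.pairOp f (X (n + 1) ω, X n ω) ∂μ =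
      μ.real (history X n ⁻¹' {b}) * M.pairOp f (j, k) := by
    rw [setIntegral_congr_fun hbm (g := fun _ => M.pairOp f (j, k))
      (fun ω hω => by simp only [hj hω, hk hω]), setIntegral_const, smul_eq_mul]
  have hright : ∫ ω in history X n ⁻¹' {b}, f (X (n + 2) ω, X (n + 1) ω) ∂μ =
      ∑ i, μ.real (X (n + 2) ⁻¹' {i} ∩ history X n ⁻¹' {b}) * f (i, j) := by
    rw [← setIntegral_comp_of_fintype (hm (n + 2)) (fun i => f (i, j))]
    exact setIntegral_congr_fun hbm fun ω hω => by simp only [hj hω]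
  refine hleft.trans (Eq.trans ?_ hright.symm)
  rw [M.pairOp_apply, Finset.mul_sum]
  refine Finset.sum_congr rfl fun i _ => ?_
  -- The path follows `b` and then takes the value `i`; its values after time `n + 2` play no role.
  have key := h.transition (fun t => if ht : t < n + 2 then b ⟨t, ht⟩ else i) n
  have h1 : {ω | ∀ s ≤ n + 1, X s ω = (if ht : s < n + 2 then b ⟨s, ht⟩ else i)} =
      history X n ⁻¹' {b} := by
    ext ω
    simp only [Set.mem_ofPred_eq, Set.mem_preimage, Set.mem_singleton_iff, funext_iff, history]
    constructor
    · intro hs s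
      have := hs s (by lia)
      rwa [dif_pos s.2] at this
    · intro hs s hsn
      rw [dif_pos (by lia)]
      exact hs ⟨s, by lia⟩
  have h2 : {ω | ∀ s ≤ n + 2, X s ω = (if ht : s < n + 2 then b ⟨s, ht⟩ else i)} =
      X (n + 2) ⁻¹' {i} ∩ history X n ⁻¹' {b} := by
    rw [← h1]
    ext ω
    simp only [Set.mem_ofPred_eq, Set.mem_preimage, Set.mem_singleton_iff, Set.mem_inter_iff]
    constructor
    · intro hs
      exact ⟨by simpa using hs (n + 2) le_rfl, fun s hsn => hs s (by lia)⟩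
    · rintro ⟨hi, hs⟩ s hsn
      rcases hsn.eq_or_lt with rfl | hlt
      · simpa using hi
      · exact hs s (by lia)
  rw [h1, h2] at key
  simp only [lt_self_iff_false, dite_false, dite_true,
    show n < n + 2 by lia, show n + 1 < n + 2 by lia] at key
  rw [key]
  simp only [j, k]
  ring

end History

/-! ### Visit fractions as averages. -/

section VisitFraction

variable {S : Type*} [DecidableEq S]

theorem visitFraction_eq_average (u : ℕ → S) (i : S) (t : ℕ) :
    visitFraction u i t = (t : ℝ)⁻¹ * ∑ s ∈ Finset.range t, if u s = i then 1 else 0 := by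
  rw [visitFraction, Finset.sum_boole, div_eq_inv_mul]

theorem visitFraction_nonneg (u : ℕ → S) (i : S) (t : ℕ) : 0 ≤ visitFraction u i t := by
  unfold visitFraction
  positivity

theorem average_eq_sum_visitFraction [Fintype S] (u : ℕ → S) (g : S → ℝ) (t : ℕ) :
    (t : ℝ)⁻¹ * ∑ s ∈ Finset.range t, g (u s) = ∑ p, g p * visitFraction u p t := by
  simp only [visitFraction_eq_average, Finset.mul_sum]
  rw [Finset.sum_comm]
  exact Finset.sum_congr rfl fun s _ => by simp [mul_comm]

theorem sum_visitFraction [Fintype S] (u : ℕ → S) {t : ℕ} (ht : 0 < t) :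
    ∑ p, visitFraction u p t = 1 := by
  have h := average_eq_sum_visitFraction u (fun _ => 1) t
  have : (t : ℝ) ≠ 0 := by positivity
  simpa [this] using h.symm

/-- The two counts differ only through the times `0` and `t`, hence by at most one. -/
theorem tendsto_visitFraction_shift_sub (u : ℕ → S) (i : S) :
    Tendsto (fun t => visitFraction (fun s => u (s + 1)) i t - visitFraction u i t) atTop
      (𝓝 0) := by
  refine squeeze_zero_norm (fun t => ?_) tendsto_inv_atTop_nhds_zero_nat
  rw [visitFraction_eq_average, visitFraction_eq_average, ← mul_sub, ← Finset.sum_sub_distrib,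
    Finset.sum_range_sub (fun s => if u s = i then (1 : ℝ) else 0), norm_mul, norm_inv,
    Real.norm_natCast]
  refine mul_le_of_le_one_right (by positivity) ?_
  split_ifs <;> simp

theorem mem_stdSimplex_of_tendsto_visitFraction [Fintype S] {u : ℕ → S} {y : S → ℝ}
    (h : ∀ p, Tendsto (visitFraction u p) atTop (𝓝 (y p))) : y ∈ stdSimplex ℝ S := by
  refine ⟨fun p => ge_of_tendsto' (h p) fun t => visitFraction_nonneg u p t, ?_⟩
  refine tendsto_nhds_unique (tendsto_finsetSum _ fun p _ => h p)
    (tendsto_const_nhds.congr' ?_)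
  filter_upwards [eventually_gt_atTop 0] with t ht
  exact (sum_visitFraction u ht).symm

theorem visitFraction_snd_eq_sum {A B : Type*} [Fintype A] [DecidableEq A]
    [DecidableEq B] (u : ℕ → A × B) (b : B) (t : ℕ) :
    visitFraction (fun s => (u s).2) b t = ∑ a, visitFraction u (a, b) t := by
  simp_rw [visitFraction_eq_average, ← Finset.mul_sum]
  rw [Finset.sum_comm]
  congr 1
  refine Finset.sum_congr rfl fun s _ => ?_
  simp [Prod.ext_iff, ite_and]

theorem visitFraction_fst_eq_sum {A B : Type*} [Fintype B] [DecidableEq A]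
    [DecidableEq B] (u : ℕ → A × B) (a : A) (t : ℕ) :
    visitFraction (fun s => (u s).1) a t = ∑ b, visitFraction u (a, b) t := by
  simp_rw [visitFraction_eq_average, ← Finset.mul_sum]
  rw [Finset.sum_comm]
  congr 1
  refine Finset.sum_congr rfl fun s _ => ?_
  simp [Prod.ext_iff, ite_and]

end VisitFraction

/-! ### Almost sure limits and their equations. -/

namespace RHOMPModel

variable {N : ℕ}

/-- The pair `(i, j)` can only be reached from pairs with current state `j`. -/
theorem sum_pairOp_single_mul (M : RHOMPModel N) (Y : Fin N × Fin N → ℝ) (i j : Fin N) :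
    ∑ p, M.pairOp (Pi.single (i, j) 1) p * Y p = ∑ k, M.trans i j k * Y (j, k) := by
  rw [Fintype.sum_prod_type]
  simp only [pairOp_apply, Pi.single_apply, Prod.mk.injEq, mul_ite, mul_one, mul_zero]
  rw [Finset.sum_eq_single j (fun a _ ha => by simp [ha]) (by simp)]
  simp

/-- A stationary law `Y` of the chain of pairs, both of whose marginals are `x`, makes `x`
stationary for `αR + (1 - α)Q`. -/
theorem eq_mix_mulVec_of_stationary (M : RHOMPModel N) {Y : Fin N × Fin N → ℝ} {x : Fin N → ℝ}
    (hY : ∀ i j, Y (i, j) = ∑ k, M.trans i j k * Y (j, k))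
    (hfst : ∀ i, x i = ∑ j, Y (i, j)) (hsnd : ∀ i, x i = ∑ j, Y (j, i)) :
    x = M.mix.mulVec x := by
  ext i
  -- The `R` term depends only on the current state and sees the first marginal; the `Q` term
  -- depends only on the previous one and sees the second.
  have hR : ∑ j, ∑ k, M.α * M.R i j * Y (j, k) = ∑ j, M.α * M.R i j * x j := by
    simp_rw [← Finset.mul_sum, ← hfst]
  have hQ : ∑ j, ∑ k, (1 - M.α) * M.Q i k * Y (j, k) = ∑ k, (1 - M.α) * M.Q i k * x k := by
    rw [Finset.sum_comm]
    simp_rw [← Finset.mul_sum, ← hsnd]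
  rw [hfst i]
  simp_rw [hY i, trans, add_mul, Finset.sum_add_distrib]
  rw [hR, hQ, ← Finset.sum_add_distrib]
  refine Finset.sum_congr rfl fun j _ => ?_
  simp [mix]
  ring

theorem IsRHOMP.ae_exists_limits {M : RHOMPModel N} {Ω : Type*} [MeasurableSpace Ω]
    {μ : Measure Ω} [IsProbabilityMeasure μ] {X : ℕ → Ω → Fin N} (h : M.IsRHOMP μ X) :
    ∀ᵐ ω ∂μ, ∃ Y ∈ stdSimplex ℝ (Fin N × Fin N), ∃ x ∈ stdSimplex ℝ (Fin N),
      (∀ j k, Tendsto (visitFraction (fun t => (X (t + 1) ω, X t ω)) (j, k)) atTop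
        (𝓝 (Y (j, k)))) ∧
      (∀ i, Tendsto (visitFraction (fun t => X t ω) i) atTop (𝓝 (x i))) ∧
      (∀ i j, Y (i, j) = ∑ k, M.trans i j k * Y (j, k)) ∧
      (∀ i, x i = ∑ j, Y (i, j)) ∧
      (∀ i, x i = ∑ j, Y (j, i)) ∧
      x = M.mix.mulVec x := by
  have hadp := stronglyMeasurable_historyFiltration h.measurable
  have hlim : ∀ᵐ ω ∂μ, ∀ p : Fin N × Fin N, ∃ c,
      Tendsto (visitFraction (fun t => (X (t + 1) ω, X t ω)) p) atTop (𝓝 c) := by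
    refine ae_all_iff.2 fun p => ?_
    have := ae_exists_tendsto_average (Z := fun t ω => (X (t + 1) ω, X t ω)) hadp h.condExp_pair
      M.norm_pairOp_le fun q => if q = p then 1 else 0
    simpa only [← visitFraction_eq_average] using this
  have hstat : ∀ᵐ ω ∂μ, ∀ p : Fin N × Fin N, Tendsto (fun n : ℕ => (n : ℝ)⁻¹ *
      ∑ k ∈ Finset.range n, ((Pi.single p 1 : Fin N × Fin N → ℝ) -
        M.pairOp (Pi.single p 1)) (X (k + 1) ω, X k ω))
      atTop (𝓝 0) :=
    ae_all_iff.2 fun p => ae_tendsto_average_coboundary (Z := fun t ω => (X (t + 1) ω, X t ω))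
      hadp h.condExp_pair _
  filter_upwards [hlim, hstat] with ω hω hst
  choose Y hY using hω
  have hx (i : Fin N) : Tendsto (visitFraction (fun t => X t ω) i) atTop (𝓝 (∑ j, Y (j, i))) :=
    (tendsto_finsetSum _ fun j _ => hY (j, i)).congr fun t =>
      (visitFraction_snd_eq_sum (fun t => (X (t + 1) ω, X t ω)) i t).symm
  -- The first coordinates of the pairs are the trajectory shifted by one step.
  have hfst (i : Fin N) : ∑ j, Y (j, i) = ∑ j, Y (i, j) := by
    refine tendsto_nhds_unique ?_ (tendsto_finsetSum Finset.univ fun j _ => hY (i, j))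
    have := (tendsto_visitFraction_shift_sub (fun t => X t ω) i).add (hx i)
    rw [zero_add] at this
    refine this.congr fun t => ?_
    rw [sub_add_cancel]
    exact visitFraction_fst_eq_sum (fun t => (X (t + 1) ω, X t ω)) i t
  -- The coboundary of the indicator of `(i, j)` has limiting average zero; expressed through visit
  -- fractions this is the balance equation.
  have hYstat (i j : Fin N) : Y (i, j) = ∑ k, M.trans i j k * Y (j, k) := by
    have h1 := hst (i, j)
    simp only [average_eq_sum_visitFraction (fun t => (X (t + 1) ω, X t ω))] at h1
    have h2 := tendsto_nhds_unique h1
      (tendsto_finsetSum Finset.univ fun p _ => (hY p).const_mul _)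
    simp only [Pi.sub_apply, sub_mul, Finset.sum_sub_distrib, sum_pairOp_single_mul] at h2
    simp only [Pi.single_apply, ite_mul, one_mul, zero_mul, Finset.sum_ite_eq',
      Finset.mem_univ, if_true] at h2
    linarith
  exact ⟨Y, mem_stdSimplex_of_tendsto_visitFraction hY, fun i => ∑ j, Y (j, i),
    mem_stdSimplex_of_tendsto_visitFraction hx, fun j k => hY (j, k), hx, hYstat, hfst,
    fun _ => rfl, M.eq_mix_mulVec_of_stationary hYstat hfst fun _ => rfl⟩

theorem mix_mem_colStochastic (M : RHOMPModel N) : M.mix ∈ Matrix.colStochastic ℝ (Fin N) :=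
  Matrix.convex_colStochastic M.R_stochastic M.Q_stochastic M.α_nonneg
    (sub_nonneg.2 M.α_le_one) (by ring)

end RHOMPModel

/-! ### Uniqueness of the stationary distribution. -/

section Irreducible

variable {S : Type*} [Fintype S] [DecidableEq S] {P : Matrix S S ℝ}

/-- A nonzero nonnegative fixed vector of an irreducible matrix has positive entries. -/
theorem Matrix.IsIrreducible.pos_of_fixed (hP : P.IsIrreducible) {v : S → ℝ} (hv : 0 ≤ v)
    (hfix : P.mulVec v = v) {j : S} (hj : v j ≠ 0) (i : S) : 0 < v i := by
  obtain ⟨k, -, hk⟩ := (Matrix.isIrreducible_iff_exists_pow_pos hP.nonneg).1 hP i j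
  have hpow (k : ℕ) : (P ^ k).mulVec v = v := by
    induction k with
    | zero => simp
    | succ k ih => rw [pow_succ, ← Matrix.mulVec_mulVec, hfix, ih]
  have hnonneg (k : ℕ) : ∀ a b, 0 ≤ (P ^ k) a b := by
    induction k with
    | zero =>
      intro a b
      rw [pow_zero, Matrix.one_apply]
      split_ifs <;> norm_num
    | succ k ih =>
      intro a b
      rw [pow_succ, Matrix.mul_apply]
      exact Finset.sum_nonneg fun c _ => mul_nonneg (ih a c) (hP.nonneg c b)
  calc 0 < (P ^ k) i j * v j := mul_pos hk (lt_of_le_of_ne (hv j) hj.symm)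
    _ ≤ ∑ l, (P ^ k) i l * v l :=
        Finset.single_le_sum (f := fun l => (P ^ k) i l * v l)
          (fun l _ => mul_nonneg (hnonneg k i l) (hv l)) (Finset.mem_univ j)
    _ = v i := congrFun (hpow k) i

/-- The absolute value of a fixed vector of a column-stochastic matrix is fixed. -/
theorem Matrix.mulVec_abs_of_fixed (hP : P ∈ Matrix.colStochastic ℝ S) {v : S → ℝ}
    (hfix : P.mulVec v = v) : P.mulVec |v| = |v| := by
  have hle (i : S) : |v| i ≤ P.mulVec |v| i := by
    have : v i = ∑ j, P i j * v j := (congrFun hfix i).symm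
    rw [Pi.abs_apply, this]
    refine (Finset.abs_sum_le_sum_abs _ _).trans_eq (Finset.sum_congr rfl fun j _ => ?_)
    rw [abs_mul, abs_of_nonneg (Matrix.nonneg_of_mem_colStochastic hP), Pi.abs_apply]
  -- `P` preserves total sums, so the entrywise inequality `|v| ≤ P |v|` must be an equality.
  have heq := (Finset.sum_eq_sum_iff_of_le fun i _ => hle i).1
    (Matrix.sum_mulVec_of_mem_colStochastic hP).symm
  exact (funext fun i => heq i (Finset.mem_univ i)).symm

/-- A fixed vector of sum zero of an irreducible column-stochastic matrix is zero. -/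
theorem Matrix.IsIrreducible.eq_zero_of_fixed_of_sum_eq_zero (hP : P.IsIrreducible)
    (hPs : P ∈ Matrix.colStochastic ℝ S) {v : S → ℝ} (hfix : P.mulVec v = v)
    (hsum : ∑ i, v i = 0) : v = 0 := by
  have habs := Matrix.mulVec_abs_of_fixed hPs hfix
  by_contra hne
  have hex : ∃ j, 0 < v j := by
    by_contra! hle
    refine hne (funext fun i => ?_)
    exact (Finset.sum_eq_zero_iff_of_nonpos fun i _ => hle i).1 hsum i (Finset.mem_univ i)
  obtain ⟨j, hj⟩ := hex
  -- `|v| + v` is fixed, nonnegative and nonzero at `j`, so it is positive everywhere. This makes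
  -- `v` positive everywhere, against its zero sum.
  have hpos (i : S) : 0 < (|v| + v) i :=
    hP.pos_of_fixed (v := |v| + v) (fun i => by
      have := neg_abs_le (v i)
      simp only [Pi.zero_apply, Pi.add_apply, Pi.abs_apply]
      linarith) (by rw [Matrix.mulVec_add, habs, hfix])
      (j := j) (by
        simp only [Pi.add_apply, Pi.abs_apply]
        have := abs_nonneg (v j)
        linarith) i
  have hvpos (i : S) : 0 < v i := by
    by_contra! hle
    have := hpos i
    rw [Pi.add_apply, Pi.abs_apply, abs_of_nonpos hle] at this
    linarith
  exact (Finset.sum_pos (fun i _ => hvpos i) ⟨j, Finset.mem_univ j⟩).ne' hsum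

theorem Matrix.IsIrreducible.unique_fixed (hP : P.IsIrreducible)
    (hPs : P ∈ Matrix.colStochastic ℝ S) {x y : S → ℝ} (hx : x ∈ stdSimplex ℝ S)
    (hy : y ∈ stdSimplex ℝ S) (hfx : x = P.mulVec x) (hfy : y = P.mulVec y) : y = x := by
  refine sub_eq_zero.1 (hP.eq_zero_of_fixed_of_sum_eq_zero hPs ?_ ?_)
  · rw [Matrix.mulVec_sub, ← hfx, ← hfy]
  · simp [hx.2, hy.2]

end Irreducible

/-! ### Construction of the process. -/

/-- The law of the path up to `n` composed with `κ n` is the joint law with the next state; this is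
evaluated at a single point. -/
theorem trajMeasure_real_cylinder {S : Type*} [Countable S] [MeasurableSpace S]
    [MeasurableSingletonClass S] (μ₀ : Measure S) [IsProbabilityMeasure μ₀]
    (κ : (n : ℕ) → ProbabilityTheory.Kernel (Finset.Iic n → S) S)
    [∀ n, ProbabilityTheory.IsMarkovKernel (κ n)] (a : ℕ → S) (n : ℕ) :
    (ProbabilityTheory.Kernel.trajMeasure (X := fun _ => S) μ₀ κ).real
        {x | ∀ s ≤ n + 1, x s = a s} =
      (ProbabilityTheory.Kernel.trajMeasure (X := fun _ => S) μ₀ κ).real {x | ∀ s ≤ n, x s = a s} *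
        (κ n fun s => a s).real {a (n + 1)} := by
  set ν := ProbabilityTheory.Kernel.trajMeasure (X := fun _ => S) μ₀ κ
  have h := ProbabilityTheory.Kernel.map_frestrictLe_trajMeasure_compProd_eq_map_trajMeasure
    (X := fun _ => S) (μ₀ := μ₀) (κ := κ) (a := n)
  have hs : MeasurableSet ({fun s : Finset.Iic n => a s} : Set (Finset.Iic n → S)) :=
    measurableSet_singleton _
  have ht : MeasurableSet ({a (n + 1)} : Set S) := measurableSet_singleton _
  have h1 := congrArg (fun m => m ({fun s : Finset.Iic n => a s} ×ˢ {a (n + 1)})) h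
  rw [Measure.compProd_apply_prod hs ht, Measure.map_apply (by fun_prop) (hs.prod ht),
    lintegral_singleton, Measure.map_apply (by fun_prop) hs] at h1
  have e1 : (Preorder.frestrictLe (π := fun _ => S) n) ⁻¹' {fun s : Finset.Iic n => a s} =
      {x | ∀ s ≤ n, x s = a s} := by
    ext x
    simp [funext_iff]
  have e2 : (fun x : ℕ → S => (Preorder.frestrictLe (π := fun _ => S) n x, x (n + 1))) ⁻¹'
      ({fun s : Finset.Iic n => a s} ×ˢ {a (n + 1)}) = {x | ∀ s ≤ n + 1, x s = a s} := by
    ext x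
    simp only [Set.mem_preimage, Set.mem_prod, Set.mem_singleton_iff, funext_iff,
      Set.mem_ofPred_eq, Preorder.frestrictLe_apply, Subtype.forall, Finset.mem_Iic,
      Order.le_succ_iff_eq_or_le, ← Order.succ_eq_add_one]
    exact ⟨fun ⟨h1, h2⟩ s hs => hs.elim (fun e => e ▸ h2) (h1 s),
      fun h => ⟨fun s hs => h s (Or.inr hs), h _ (Or.inl rfl)⟩⟩
  rw [e1, e2] at h1
  rw [measureReal_def, measureReal_def, measureReal_def, ← ENNReal.toReal_mul, mul_comm, h1]

theorem trajMeasure_map_zero {S : Type*} [MeasurableSpace S]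
    (μ₀ : Measure S) [IsProbabilityMeasure μ₀]
    (κ : (n : ℕ) → ProbabilityTheory.Kernel (Finset.Iic n → S) S)
    [∀ n, ProbabilityTheory.IsMarkovKernel (κ n)] :
    (ProbabilityTheory.Kernel.trajMeasure (X := fun _ => S) μ₀ κ).map (fun x => x 0) = μ₀ := by
  have h : (ProbabilityTheory.Kernel.trajMeasure (X := fun _ => S) μ₀ κ).map
      (Preorder.frestrictLe (π := fun _ => S) 0) =
      μ₀.map (MeasurableEquiv.piUnique (fun _ : Finset.Iic 0 => S)).symm := by
    rw [ProbabilityTheory.Kernel.trajMeasure, Measure.map_comp _ _ (by fun_prop),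
      ProbabilityTheory.Kernel.traj_map_frestrictLe, ProbabilityTheory.Kernel.partialTraj_self,
      Measure.id_comp]
  have h0 : (fun x : ℕ → S => x 0) =
      (fun u : Finset.Iic 0 → S => u ⟨0, by simp⟩) ∘ Preorder.frestrictLe (π := fun _ => S) 0 :=
    rfl
  rw [h0, ← Measure.map_map (by fun_prop) (by fun_prop), h,
    Measure.map_map (by fun_prop) (by fun_prop)]
  exact Measure.map_id

theorem exists_measure_real_singleton {S : Type*} [Fintype S] [MeasurableSpace S]
    [MeasurableSingletonClass S] {p : S → ℝ} (hp : p ∈ stdSimplex ℝ S) :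
    ∃ ρ : Measure S, IsProbabilityMeasure ρ ∧ ∀ i, ρ.real {i} = p i := by
  have hsum : ∑ i, ENNReal.ofReal (p i) = 1 := by
    rw [← ENNReal.ofReal_sum_of_nonneg fun i _ => hp.1 i, hp.2, ENNReal.ofReal_one]
  refine ⟨(PMF.ofFintype _ hsum).toMeasure, inferInstance, fun i => ?_⟩
  rw [measureReal_def, PMF.toMeasure_apply_singleton _ _ (measurableSet_singleton i),
    PMF.ofFintype_apply, ENNReal.toReal_ofReal (hp.1 i)]

theorem exists_markovKernel_real_singleton {A S : Type*} [Finite A] [MeasurableSpace A]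
    [MeasurableSingletonClass A] [Fintype S] [MeasurableSpace S] [MeasurableSingletonClass S]
    {p : A → S → ℝ} (hp : ∀ a, p a ∈ stdSimplex ℝ S) :
    ∃ κ : ProbabilityTheory.Kernel A S, ProbabilityTheory.IsMarkovKernel κ ∧
      ∀ a i, (κ a).real {i} = p a i := by
  choose ρ hρ hρp using fun a => exists_measure_real_singleton (hp a)
  exact ⟨⟨ρ, measurable_of_finite ρ⟩, ⟨hρ⟩, hρp⟩

namespace RHOMPModel

theorem exists_isRHOMP {N : ℕ} (hN : 0 < N) (M : RHOMPModel N) {p : Fin N × Fin N → ℝ}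
    (hp : p ∈ stdSimplex ℝ (Fin N × Fin N)) :
    ∃ (Ω : Type) (_ : MeasurableSpace Ω) (μ : Measure Ω) (_ : IsProbabilityMeasure μ)
      (X : ℕ → Ω → Fin N),
      M.IsRHOMP μ X ∧ ∀ j k : Fin N, μ.real {ω | X 1 ω = j ∧ X 0 ω = k} = p (j, k) := by
  have : Nonempty (Fin N) := ⟨⟨0, hN⟩⟩
  -- `p` lists the later state first, while `ρ` has to be the law of `(X 0, X 1)` in order of time.
  have hpswap : (fun q : Fin N × Fin N => p q.swap) ∈ stdSimplex ℝ (Fin N × Fin N) :=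
    ⟨fun q => hp.1 _, by rw [← hp.2]; exact (Equiv.prodComm _ _).sum_comp p⟩
  obtain ⟨ρ, hρ, hρp⟩ := exists_measure_real_singleton hpswap
  have hstep (n : ℕ) := exists_markovKernel_real_singleton
    (p := fun (u : Finset.Iic (n + 1) → Fin N) i =>
      M.trans i (u ⟨n + 1, by simp⟩) (u ⟨n, by simp⟩))
    fun u => ⟨fun i => M.trans_nonneg _ _ _, M.sum_trans _ _⟩
  choose κ' hκ' hκp using hstep
  -- `M.trans` needs two past states, so the first step instead disintegrates `ρ` over its first
  -- marginal.
  let κ : (n : ℕ) → ProbabilityTheory.Kernel (Finset.Iic n → Fin N) (Fin N) := fun n =>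
    match n with
    | 0 => ρ.condKernel.comap (fun u => u ⟨0, by simp⟩) (by fun_prop)
    | n + 1 => κ' n
  have hκ : ∀ n, ProbabilityTheory.IsMarkovKernel (κ n)
    | 0 => by dsimp only [κ]; infer_instance
    | n + 1 => hκ' n
  refine ⟨ℕ → Fin N, inferInstance,
    ProbabilityTheory.Kernel.trajMeasure (X := fun _ => Fin N) ρ.fst κ, inferInstance,
    fun t x => x t, ⟨fun t => measurable_pi_apply t, fun a n => ?_⟩, fun j k => ?_⟩
  · rw [trajMeasure_real_cylinder ρ.fst κ a (n + 1)]
    congr 1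
    exact hκp n _ _
  · have h1 := trajMeasure_real_cylinder ρ.fst κ (fun t => if t = 0 then k else j) 0
    have e1 : {x : ℕ → Fin N | ∀ s ≤ 0 + 1, x s = if s = 0 then k else j} =
        {x | x 1 = j ∧ x 0 = k} := by
      ext x
      simp [Nat.le_one_iff_eq_zero_or_eq_one, or_imp, forall_and, and_comm]
    have e2 : {x : ℕ → Fin N | ∀ s ≤ 0, x s = if s = 0 then k else j} =
        (fun x => x 0) ⁻¹' {k} := by
      ext x
      simp
    rw [e1, e2, ← map_measureReal_apply (measurable_pi_apply 0) (measurableSet_singleton k),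
      trajMeasure_map_zero ρ.fst κ] at h1
    rw [h1]
    have h2 : (ρ.fst.compProd ρ.condKernel).real ({k} ×ˢ {j}) = p (j, k) := by
      rw [Measure.disintegrate, Set.singleton_prod_singleton, hρp]
      rfl
    rw [← h2, measureReal_def, measureReal_def, measureReal_def,
      Measure.compProd_apply_prod (measurableSet_singleton k) (measurableSet_singleton j),
      lintegral_singleton, mul_comm, ENNReal.toReal_mul]
    rfl

end RHOMPModel

/-! ### Assembly. -/

theorem theorem1 {N : ℕ} (hN : 0 < N) (M : RHOMPModel N) :
    -- from every initial law of the first two states there is such a process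
    (∀ p ∈ stdSimplex ℝ (Fin N × Fin N),
      ∃ (Ω : Type) (_ : MeasurableSpace Ω) (μ : Measure Ω) (_ : IsProbabilityMeasure μ)
        (X : ℕ → Ω → Fin N),
        M.IsRHOMP μ X ∧ ∀ j k : Fin N, μ.real {ω | X 1 ω = j ∧ X 0 ω = k} = p (j, k)) ∧
    -- almost surely the limiting distributions `Y` of the (current, previous) pair and `x` of the
    -- state exist, `Y` is stationary for the chain of pairs, both marginals of `Y` are `x`,
    -- and `x = (αR + (1 - α)Q) x`
    (∀ (Ω : Type*) [MeasurableSpace Ω] (μ : Measure Ω) [IsProbabilityMeasure μ]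
        (X : ℕ → Ω → Fin N), M.IsRHOMP μ X →
      ∀ᵐ ω ∂μ, ∃ Y ∈ stdSimplex ℝ (Fin N × Fin N), ∃ x ∈ stdSimplex ℝ (Fin N),
        (∀ j k, Tendsto (visitFraction (fun t => (X (t + 1) ω, X t ω)) (j, k)) atTop
          (𝓝 (Y (j, k)))) ∧
        (∀ i, Tendsto (visitFraction (fun t => X t ω) i) atTop (𝓝 (x i))) ∧
        (∀ i j, Y (i, j) = ∑ k, M.trans i j k * Y (j, k)) ∧
        (∀ i, x i = ∑ j, Y (i, j)) ∧
        (∀ i, x i = ∑ j, Y (j, i)) ∧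
        x = M.mix.mulVec x) ∧
    -- if `αR + (1 - α)Q` is irreducible, then the limiting distribution is unique: it is one and
    -- the same for all processes with these parameters and almost all of their trajectories,
    -- and it is the only distribution with `x = (αR + (1 - α)Q) x`
    (M.mix.IsIrreducible →
      ∃ x ∈ stdSimplex ℝ (Fin N),
        x = M.mix.mulVec x ∧
        (∀ y ∈ stdSimplex ℝ (Fin N), y = M.mix.mulVec y → y = x) ∧
        ∀ (Ω : Type*) [MeasurableSpace Ω] (μ : Measure Ω) [IsProbabilityMeasure μ]
          (X : ℕ → Ω → Fin N), M.IsRHOMP μ X →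
          ∀ᵐ ω ∂μ, ∀ i, Tendsto (visitFraction (fun t => X t ω) i) atTop (𝓝 (x i))) := by
  refine ⟨fun p hp => M.exists_isRHOMP hN hp, fun Ω _ μ _ X h => h.ae_exists_limits,
    fun hirr => ?_⟩
  have hunique {x y : Fin N → ℝ} := hirr.unique_fixed M.mix_mem_colStochastic (x := x) (y := y)
  -- A stationary distribution is read off from one typical trajectory of a process started at a
  -- fixed pair.
  obtain ⟨x, hx, hfix⟩ : ∃ x ∈ stdSimplex ℝ (Fin N), x = M.mix.mulVec x := by
    obtain ⟨Ω, _, μ, _, X, h, -⟩ := M.exists_isRHOMP hN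
      (single_mem_stdSimplex ℝ ((⟨0, hN⟩, ⟨0, hN⟩) : Fin N × Fin N))
    obtain ⟨ω, Y, -, x, hx, -, -, -, -, -, hfix⟩ := h.ae_exists_limits.exists
    exact ⟨x, hx, hfix⟩
  refine ⟨x, hx, hfix, fun y hy hfy => hunique hx hy hfix hfy, fun Ω _ μ _ X h => ?_⟩
  filter_upwards [h.ae_exists_limits] with ω ⟨_, _, y, hy, _, hlim, _, _, _, hfy⟩
  rw [← hunique hx hy hfix hfy]
  exact hlim
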